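/- Let $K$ be a field of characteristic $0$, $n\ge 0$, $S=K[x_0,\dots,x_n]$, and fix any term order on $S$. Let $I_\bullet=(I_m)_{m\ge 0}$ be a graded system of homogeneous ideals of $S$, i.e. $I_pI_q\subseteq I_{p+q}$ for all $p,q\ge 0$, such that the initial ideal $\mathrm{in}(I_m)$ is Borel-fixed for every $m$: it is mapped into itself by every invertible upper triangular matrix $g=(g_{ij})$, acting by $x_j\mapsto\sum_{i\le j} g_{ij}x_i$. For $s,t\in\mathbb R$ put $T^n_s=\{\beta\in\mathbb R^n_{\ge 0}:\beta_0+\dots+\beta_{n-1}\le s\}$, and for $m\ge 1$ $$M_{m,t}=\bigcup_{x^\alpha\in \mathrm{in}(I_m)}\{\beta\in\mathbb R^n:\beta_j\ge\alpha_j\ (0\le j\le n-1),\ \beta_0+\dots+\beta_{n-1}\le mt-\alpha_n\},$$ $$L_{m,t}=\Big(\bigcup_{\beta\in M_{m,t}}(\beta+\mathbb R^n_{\ge 0})\Big)\cap T^n_{mt},\qquad \Gamma(I_\bullet,t)=\overline{\bigcap_{m\ge 1}\Big(T^n_{mt}\setminus \tfrac1m L_{m,t}\Big)}\subseteq\mathbb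 R^n .$$ Let $\mathrm{HF}_I(d)=\dim_K (S/I)_d$ for $d\in\mathbb Z$ (so $\mathrm{HF}_I(d)=0$ for $d<0$). The asymptotic Hilbert function is $$\mathrm{aHF}_{I_\bullet}(t)=\lim_{m\to\infty}\frac{\mathrm{HF}_{I_m}(\lfloor mt\rfloor)}{m^n}$$ for each real $t$ for which this limit exists in $\mathbb R$. Then, for every real number $t$: (1) if $I_m\ne 0$ for all $m\ge 1$ and $t\neq\widehat\alpha(I_\bullet)$, the limit defining $\mathrm{aHF}_{I_\bullet}(t)$ exists, where $\widehat\alpha(I_\bullet)=\lim_{m\to\infty}\alpha(I_m)/m$ is the Waldschmidt constant and $\alpha(I)$ is the least degree of a nonzero form in $I$; (2) whenever the limit defining $\mathrm{aHF}_{I_\bullet}(t)$ exists, $$\mathrm{vol}\big(\Gamma(I_\bullet,t)\big)=\mathrm{aHF}_{I_\bullet}(t).$$ -/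

import Mathlib

open Filter Topology MeasureTheory
open scoped Pointwise

noncomputable section

namespace GradedSystem

/-- `I` is a homogeneous ideal for the standard grading of the polynomial ring. -/
def IsHomogeneousIdeal {K : Type*} [Field K] {n : ℕ}
    (I : Ideal (MvPolynomial (Fin (n + 1)) K)) : Prop :=
  letI : GradedAlgebra (MvPolynomial.homogeneousSubmodule (Fin (n + 1)) K) :=
    MvPolynomial.gradedAlgebra
  I.IsHomogeneous (MvPolynomial.homogeneousSubmodule (Fin (n + 1)) K)

/-- The initial ideal of `I` with respect to the term order `ord`: the ideal generated by the
leading terms of the elements of `I`. -/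
def initialIdeal {K : Type*} [Field K] {n : ℕ} (ord : MonomialOrder (Fin (n + 1)))
    (I : Ideal (MvPolynomial (Fin (n + 1)) K)) : Ideal (MvPolynomial (Fin (n + 1)) K) :=
  Ideal.span (ord.leadingTerm '' (I : Set (MvPolynomial (Fin (n + 1)) K)))

/-- The linear change of coordinates given by a matrix `g`, acting on polynomials by
`x_j ↦ ∑ i, g i j * x_i`. -/
def linearSubst {K : Type*} [Field K] {n : ℕ} (g : Matrix (Fin (n + 1)) (Fin (n + 1)) K) :
    MvPolynomial (Fin (n + 1)) K →ₐ[K] MvPolynomial (Fin (n + 1)) K :=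
  MvPolynomial.aeval fun j => ∑ i, MvPolynomial.C (g i j) * MvPolynomial.X i

/-- `I` is Borel-fixed: it is mapped into itself by every invertible upper triangular matrix,
where `g` acts by `x_j ↦ ∑ i, g i j * x_i` (so `x_j` goes to a combination of the `x_i`, `i ≤ j`). -/
def IsBorelFixed {K : Type*} [Field K] {n : ℕ} (I : Ideal (MvPolynomial (Fin (n + 1)) K)) : Prop :=
  ∀ g : Matrix.GeneralLinearGroup (Fin (n + 1)) K,
    (g : Matrix (Fin (n + 1)) (Fin (n + 1)) K).BlockTriangular id →
      ∀ f ∈ I, linearSubst (g : Matrix (Fin (n + 1)) (Fin (n + 1)) K) f ∈ I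

/-- The simplex `T_s^n = {β ∈ ℝ^n : β ≥ 0, ∑ β_j ≤ s}`. -/
def simplexT (n : ℕ) (s : ℝ) : Set (Fin n → ℝ) :=
  {β | (∀ j, 0 ≤ β j) ∧ ∑ j, β j ≤ s}

/-- The set `M_{m,t}`: the union over the monomials `x^α` of the initial ideal of `I_m` of
`{β : β_j ≥ α_j for j < n, ∑ β_j ≤ m t - α_n}`. -/
def setM {K : Type*} [Field K] {n : ℕ} (ord : MonomialOrder (Fin (n + 1)))
    (I : ℕ → Ideal (MvPolynomial (Fin (n + 1)) K)) (m : ℕ) (t : ℝ) : Set (Fin n → ℝ) :=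
  {β | ∃ α : Fin (n + 1) →₀ ℕ,
    MvPolynomial.monomial α (1 : K) ∈ initialIdeal ord (I m) ∧
      (∀ j : Fin n, (α j.castSucc : ℝ) ≤ β j) ∧
      ∑ j, β j ≤ m * t - (α (Fin.last n) : ℝ)}

/-- The set `L_{m,t} = (⋃_{α ∈ M_{m,t}} (α + ℝ_{≥0}^n)) ∩ T_{mt}^n`. -/
def setL {K : Type*} [Field K] {n : ℕ} (ord : MonomialOrder (Fin (n + 1)))
    (I : ℕ → Ideal (MvPolynomial (Fin (n + 1)) K)) (m : ℕ) (t : ℝ) : Set (Fin n → ℝ) :=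
  {γ | ∃ β ∈ setM ord I m t, ∀ j, β j ≤ γ j} ∩ simplexT n (m * t)

/-- The restricted complement of the limiting shape:
`Γ(I_•,t)` is the closure of `⋂_{m ≥ 1} (T_{mt}^n \ L_{m,t} / m)`. -/
def complementShape {K : Type*} [Field K] {n : ℕ} (ord : MonomialOrder (Fin (n + 1)))
    (I : ℕ → Ideal (MvPolynomial (Fin (n + 1)) K)) (t : ℝ) : Set (Fin n → ℝ) :=
  closure (⋂ (m : ℕ) (_ : 1 ≤ m), simplexT n (m * t) \ ((m : ℝ)⁻¹ • setL ord I m t))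

/-- The Hilbert function `HF_I(d) = dim_K (S/I)_d`; the degree `d` part of `S/I` is the image of
the space of forms of degree `d`. -/
def hilbertFunction {K : Type*} [Field K] {n : ℕ} (I : Ideal (MvPolynomial (Fin (n + 1)) K))
    (d : ℕ) : ℕ :=
  Module.finrank K
    ((MvPolynomial.homogeneousSubmodule (Fin (n + 1)) K d).map (Ideal.Quotient.mkₐ K I).toLinearMap)

/-- The Hilbert function extended to real arguments, `s ↦ HF_I(⌊s⌋)`
(zero for negative `s`, since `S/I` has no elements of negative degree). -/
def extHilbertFunction {K : Type*} [Field K] {n : ℕ} (I : Ideal (MvPolynomial (Fin (n + 1)) K))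
    (s : ℝ) : ℕ :=
  if s < 0 then 0 else hilbertFunction I ⌊s⌋₊

/-- The sequence `m ↦ HF_{I_m}(m t) / m^n`. -/
def hilbertSeq {K : Type*} [Field K] {n : ℕ} (I : ℕ → Ideal (MvPolynomial (Fin (n + 1)) K))
    (t : ℝ) (m : ℕ) : ℝ :=
  (extHilbertFunction (I m) (m * t) : ℝ) / (m : ℝ) ^ n

/-- The asymptotic Hilbert function `aHF_{I_•}(t) = lim_m HF_{I_m}(m t) / m^n`. -/
def asymptoticHilbertFunction {K : Type*} [Field K] {n : ℕ}
    (I : ℕ → Ideal (MvPolynomial (Fin (n + 1)) K)) (t : ℝ) : ℝ :=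
  limUnder atTop (hilbertSeq I t)

/-- The least degree `α(I)` of a nonzero form in `I` (used for nonzero homogeneous `I`). -/
def leastDegree {K : Type*} [Field K] {n : ℕ} (I : Ideal (MvPolynomial (Fin (n + 1)) K)) : ℕ :=
  sInf {d | ∃ f ∈ I, f ≠ 0 ∧ f.IsHomogeneous d}

/-- The Waldschmidt constant `lim_m α(I_m) / m`; for a graded system of nonzero homogeneous ideals
the sequence `α(I_m)` is subadditive, so that the limit exists. -/
def waldschmidtConstant {K : Type*} [Field K] {n : ℕ}
    (I : ℕ → Ideal (MvPolynomial (Fin (n + 1)) K)) : ℝ :=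
  limUnder atTop fun m : ℕ => (leastDegree (I m) : ℝ) / (m : ℝ)

end GradedSystem

end

/-!
The Hilbert function of `I_m` in degree `⌊mt⌋` is turned into the volume of a set `F_m ⊆ ℝ^n`, and
the sets `F_m` are shown to converge almost everywhere to `Γ(I_•,t)`.

By Macaulay's basis theorem (`hilbertFunction_eq_ncard`) the Hilbert function counts the monomials
outside the initial ideal. In characteristic zero a Borel-fixed monomial ideal is stable under
replacing `x_n` by an earlier variable (`exchange_mem_initialExponents`); hence a monomial of degree
`⌊mt⌋` lies in `in(I_m)` as soon as its first `n` exponents dominate those of an initial monomial of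
degree at most `mt`, that is, belong to the `shadow`. Dropping the last exponent, the Hilbert
function counts the lattice points of `T_{mt}^n` outside the shadow (`extHilbertFunction_eq_ncard`).
Attaching a half-open cube of side `1/m` to each of these points, scaled by `1/m`, gives a set
`F_m` of volume exactly `HF_{I_m}(⌊mt⌋) / m^n` (`volume_cells_outerLattice`).

Since the shadows are upper sets, `Γ(I_•,t)` is the closure of an order-connected set `W`
(`complementShape_eq_closure`, `ordConnected_outerShape`), whose frontier is a null set. A point of
`W` lies in every `F_m`. Let `γ` be a point of the interior of `T_t^n` outside the closure of `W`.
A small translate of `γ` in the direction `-(1,…,1)` lies in some scaled shadow, coming from an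
initial exponent `α` of `I_q`. As the initial exponents are additive along the graded system,
multiples of `α`, corrected by one of finitely many initial exponents `β` of other members, show
that `γ` lies in the scaled shadow of `I_m` for all large `m` (`eventually_smul_mem_shadow`). The
correction needs nonempty shadows, so it works for all large multiples `m` of `p` as soon as the
shadows of the `I_{kp}` are nonempty for large `k`; if all shadows are empty there is nothing to
prove. Dominated convergence then gives `tendsto_hilbertSeq_mul`: along the multiples of `p`, the
normalized Hilbert functions converge to the volume of `Γ(I_•,t)`.

If `t` is not the Waldschmidt constant, `p = 1` is allowed by Fekete's lemma
(`shadows_empty_or_eventually_nonempty`), and the whole sequence converges. If the limit is known to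
exist, it can be computed along the multiples of any `p` whose shadow is nonempty.
-/

namespace GradedSystem

open MvPolynomial

/-! ### Initial exponents and standard monomials -/

section Algebra

variable {K : Type*} [Field K] {n : ℕ} {ord : MonomialOrder (Fin (n + 1))}
  {I J : Ideal (MvPolynomial (Fin (n + 1)) K)}

/-- The exponents of the leading monomials of the nonzero elements of `I`, with respect to the
term order `ord`. -/
def initialExponents (ord : MonomialOrder (Fin (n + 1)))
    (I : Ideal (MvPolynomial (Fin (n + 1)) K)) : Set (Fin (n + 1) →₀ ℕ) :=
  {α | ∃ f ∈ I, f ≠ 0 ∧ ord.degree f = α}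

lemma initialExponents_add {α β : Fin (n + 1) →₀ ℕ} {L : Ideal (MvPolynomial (Fin (n + 1)) K)}
    (hIJ : I * J ≤ L) (hα : α ∈ initialExponents ord I) (hβ : β ∈ initialExponents ord J) :
    α + β ∈ initialExponents ord L := by
  obtain ⟨f, hf, hf0, rfl⟩ := hα
  obtain ⟨g, hg, hg0, rfl⟩ := hβ
  exact ⟨f * g, hIJ (Ideal.mul_mem_mul hf hg), mul_ne_zero hf0 hg0, ord.degree_mul hf0 hg0⟩

lemma isUpperSet_initialExponents : IsUpperSet (initialExponents ord I) := by
  classical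
  rintro _ β hle ⟨f, hf, hf0, rfl⟩
  have hm : monomial (β - ord.degree f) (1 : K) ≠ 0 := by simp
  refine ⟨monomial (β - ord.degree f) 1 * f, I.mul_mem_left _ hf, mul_ne_zero hm hf0, ?_⟩
  rw [ord.degree_mul hm hf0, ord.degree_monomial, if_neg one_ne_zero, tsub_add_cancel_of_le hle]

lemma initialIdeal_eq_span :
    initialIdeal ord I =
      Ideal.span ((fun s => monomial s (1 : K)) '' initialExponents ord I) := by
  rw [initialIdeal, MonomialOrder.span_leadingTerm_eq_span_monomial']
  congr 1
  ext p
  constructor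
  · rintro ⟨f, ⟨hf, hf0⟩, rfl⟩
    exact ⟨_, ⟨f, hf, hf0, rfl⟩, rfl⟩
  · rintro ⟨_, ⟨f, hf, hf0, rfl⟩, rfl⟩
    exact ⟨f, ⟨hf, hf0⟩, rfl⟩

lemma mem_initialIdeal_iff {p : MvPolynomial (Fin (n + 1)) K} :
    p ∈ initialIdeal ord I ↔ ∀ α ∈ p.support, α ∈ initialExponents ord I := by
  rw [initialIdeal_eq_span, mem_ideal_span_monomial_image]
  exact forall₂_congr fun α _ => ⟨fun ⟨_, hs, hle⟩ => isUpperSet_initialExponents hle hs,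
    fun h => ⟨α, h, le_rfl⟩⟩

lemma monomial_mem_initialIdeal_iff {α : Fin (n + 1) →₀ ℕ} :
    monomial α (1 : K) ∈ initialIdeal ord I ↔ α ∈ initialExponents ord I := by
  classical
  simp [mem_initialIdeal_iff, support_monomial]

/-- An initial exponent of a homogeneous ideal is the leading exponent of a form. -/
lemma exists_form_of_mem_initialExponents (hI : IsHomogeneousIdeal I)
    {α : Fin (n + 1) →₀ ℕ} (hα : α ∈ initialExponents ord I) :
    ∃ f ∈ I, f ≠ 0 ∧ f.IsHomogeneous α.degree ∧ ord.degree f = α := by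
  obtain ⟨f, hf, hf0, rfl⟩ := hα
  set d := (ord.degree f).degree
  have hc : coeff (ord.degree f) (homogeneousComponent d f) ≠ 0 := by
    rw [coeff_homogeneousComponent, if_pos rfl]
    exact ord.coeff_degree_ne_zero_iff.2 hf0
  refine ⟨homogeneousComponent d f, homogeneousComponent_mem_of_mem hI hf d,
    fun h => hc (by simp [h]), homogeneousComponent_isHomogeneous d f, ?_⟩
  apply ord.toSyn.injective
  refine le_antisymm (ord.degree_le_iff.2 fun c hcs => ord.le_degree ?_)
    (ord.le_degree (mem_support_iff.2 hc))
  rw [mem_support_iff, coeff_homogeneousComponent] at hcs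
  exact mem_support_iff.2 fun h => hcs (by simp [h])

/-- The exponents of degree `d` of the standard monomials, those outside the initial ideal. -/
def standardExponents (ord : MonomialOrder (Fin (n + 1)))
    (I : Ideal (MvPolynomial (Fin (n + 1)) K)) (d : ℕ) : Set (Fin (n + 1) →₀ ℕ) :=
  {α | α.degree = d ∧ α ∉ initialExponents ord I}

/-- Reduction modulo `I`: every monomial agrees modulo `I` with a combination of standard
monomials of the same degree. -/
lemma monomial_mem_restrictSupport_sup (hI : IsHomogeneousIdeal I) (d : ℕ)
    (α : Fin (n + 1) →₀ ℕ) (hα : α.degree = d) :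
    monomial α (1 : K) ∈
      restrictSupport K (standardExponents ord I d) ⊔ I.restrictScalars K := by
  have key : ∀ s : ord.syn, ∀ α : Fin (n + 1) →₀ ℕ, ord.toSyn α = s → α.degree = d →
      monomial α (1 : K) ∈
        restrictSupport K (standardExponents ord I d) ⊔ I.restrictScalars K := by
    intro s
    induction s using WellFoundedLT.induction with
    | ind s ih =>
      intro α hs hα
      by_cases hin : α ∈ initialExponents ord I
      · obtain ⟨f, hf, hf0, hfh, hfd⟩ := exists_form_of_mem_initialExponents hI hin
        have hc : coeff α f ≠ 0 := by rw [← hfd]; exact ord.coeff_degree_ne_zero_iff.2 hf0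
        -- all the other monomials of `f` are smaller and of the same degree
        have hrest : ∀ β ∈ f.support.erase α, monomial β (coeff β f) ∈
            restrictSupport K (standardExponents ord I d) ⊔ I.restrictScalars K := by
          intro β hβ
          obtain ⟨hne, hβ⟩ := Finset.mem_erase.1 hβ
          have hlt : ord.toSyn β < s := by
            rw [← hs]
            refine lt_of_le_of_ne ?_ fun h => hne (ord.toSyn.injective h)
            rw [← hfd]; exact ord.le_degree hβ
          have hdeg : β.degree = d := by
            by_contra h
            exact mem_support_iff.1 hβ (hfh.coeff_eq_zero (by rwa [hα]))
          have := Submodule.smul_mem _ (coeff β f) (ih _ hlt β rfl hdeg)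
          rwa [smul_monomial, smul_eq_mul, mul_one] at this
        have hf' : f ∈ restrictSupport K (standardExponents ord I d) ⊔ I.restrictScalars K :=
          Submodule.mem_sup_right hf
        rw [f.as_sum, ← Finset.add_sum_erase _ _ (mem_support_iff.2 hc)] at hf'
        have := (Submodule.add_mem_iff_left _ (Submodule.sum_mem _ hrest)).1 hf'
        have := Submodule.smul_mem _ (coeff α f)⁻¹ this
        rwa [smul_monomial, smul_eq_mul, inv_mul_cancel₀ hc] at this
      · exact Submodule.mem_sup_left ((monomial_mem_restrictSupport K).2 (Or.inl ⟨hα, hin⟩))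
  exact key _ α rfl hα

/-- Macaulay: the standard monomials of degree `d` are a basis of the degree `d` part of `S/I`. -/
lemma hilbertFunction_eq_ncard (ord : MonomialOrder (Fin (n + 1))) (hI : IsHomogeneousIdeal I)
    (d : ℕ) : hilbertFunction I d = (standardExponents ord I d).ncard := by
  set W := restrictSupport K (standardExponents ord I d)
  set φ := (Ideal.Quotient.mkₐ K I).toLinearMap
  have hφ : ∀ p, φ p = 0 ↔ p ∈ I := fun p => Ideal.Quotient.eq_zero_iff_mem
  have hWle : W ≤ homogeneousSubmodule (Fin (n + 1)) K d := by
    rw [homogeneousSubmodule_eq_finsupp_supported]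
    exact restrictSupport_mono K fun α (hα : α ∈ standardExponents ord I d) => hα.1
  have hmap : (homogeneousSubmodule (Fin (n + 1)) K d).map φ = W.map φ := by
    refine le_antisymm ?_ (Submodule.map_mono hWle)
    rintro _ ⟨p, hp, rfl⟩
    have : p ∈ W ⊔ I.restrictScalars K := by
      rw [p.as_sum]
      refine Submodule.sum_mem _ fun α hα => ?_
      have hdeg : α.degree = d := by
        by_contra h
        exact mem_support_iff.1 hα (IsHomogeneous.coeff_eq_zero hp h)
      have := Submodule.smul_mem _ (coeff α p) 
        (monomial_mem_restrictSupport_sup (ord := ord) hI d α hdeg)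
      rwa [smul_monomial, smul_eq_mul, mul_one] at this
    obtain ⟨w, hw, q, hq, rfl⟩ := Submodule.mem_sup.1 this
    exact ⟨w, hw, by rw [map_add, (hφ q).2 hq, add_zero]⟩
  have hinj : Function.Injective (φ.comp W.subtype) := by
    rw [injective_iff_map_eq_zero]
    rintro ⟨w, hw⟩ h0
    by_contra hne
    have hw0 : w ≠ 0 := fun h => hne (Subtype.ext h)
    have hwI : w ∈ I := (hφ w).1 h0
    exact (hw (ord.degree_mem_support hw0)).2 ⟨w, hwI, hw0, rfl⟩
  rw [hilbertFunction, hmap, ← Submodule.range_subtype W, ← LinearMap.range_comp,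
    LinearMap.finrank_range_of_inj hinj,
    Module.finrank_eq_nat_card_basis (basisRestrictSupport K (standardExponents ord I d))]
  rfl

/-- In characteristic zero a Borel-fixed initial ideal is stable under replacing the last variable
by an earlier one: the substitution `x_n ↦ x_n + x_i` produces the new monomial with the nonzero
coefficient `α_n`. -/
lemma exchange_mem_initialExponents [CharZero K] (hB : IsBorelFixed (initialIdeal ord I))
    {α : Fin (n + 1) →₀ ℕ} {i : Fin (n + 1)} (hi : i < Fin.last n)
    (hα : α + Finsupp.single (Fin.last n) 1 ∈ initialExponents ord I) :
    α + Finsupp.single i 1 ∈ initialExponents ord I := by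
  classical
  have hlin : (Fin.last n) ≠ i := hi.ne'
  set g : Matrix (Fin (n + 1)) (Fin (n + 1)) K := Matrix.transvection i (Fin.last n) 1 with hg
  have hgapp : ∀ a b, g a b =
      (if a = b then 1 else 0) + if i = a ∧ Fin.last n = b then 1 else 0 := fun a b => by
    simp [hg, Matrix.transvection, Matrix.one_apply, Matrix.single_apply]
  have hdet : g.det ≠ 0 := by
    rw [hg, Matrix.det_transvection_of_ne _ _ hlin.symm]
    exact one_ne_zero
  have htri : g.BlockTriangular id := by
    intro a b hab
    have hab : b < a := hab
    rw [hgapp, if_neg hab.ne', if_neg, add_zero]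
    rintro ⟨rfl, rfl⟩
    exact lt_asymm hi hab
  have hX : ∀ j, (∑ a, C (g a j) * X a : MvPolynomial (Fin (n + 1)) K) =
      X j + if Fin.last n = j then X i else 0 := fun j => by
    simp only [hgapp, map_add, add_mul, Finset.sum_add_distrib]
    congr 1
    · simp [apply_ite C, ite_mul]
    · by_cases h : Fin.last n = j <;> simp [h, apply_ite C, ite_mul]
  have hmem : linearSubst g (monomial (α + Finsupp.single (Fin.last n) 1) 1) ∈
      initialIdeal ord I := by
    have := hB (Matrix.GeneralLinearGroup.mkOfDetNeZero g hdet) htri _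
      (monomial_mem_initialIdeal_iff.2 hα)
    exact this
  set k := α (Fin.last n)
  set γ := α.erase (Fin.last n) with hγ
  have hαγ : α = Finsupp.single (Fin.last n) k + γ := (Finsupp.single_add_erase _ _).symm
  have hγX : linearSubst g (monomial γ 1) = monomial γ 1 := by
    rw [linearSubst, aeval_monomial, map_one, one_mul, monomial_eq, C_1, one_mul]
    refine Finsupp.prod_congr fun j hj => ?_
    rw [hX, if_neg, add_zero]
    rintro rfl
    simp [hγ] at hj
  have himage : linearSubst g (monomial (α + Finsupp.single (Fin.last n) 1) 1) =
      monomial γ 1 * (X (Fin.last n) + X i) ^ (k + 1) := by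
    have h1 : α + Finsupp.single (Fin.last n) 1 = γ + Finsupp.single (Fin.last n) (k + 1) := by
      rw [hαγ, add_comm _ γ, add_assoc, ← Finsupp.single_add]
    have h2 : linearSubst g (X (Fin.last n)) = X (Fin.last n) + X i := by
      rw [linearSubst, aeval_X, hX, if_pos rfl]
    rw [h1, ← mul_one (1 : K), ← monomial_mul, mul_one, map_mul, hγX, ← h2, ← map_pow,
      X_pow_eq_monomial]
  rw [himage] at hmem
  refine mem_initialIdeal_iff.1 hmem _ (mem_support_iff.2 ?_)
  have h3 : α + Finsupp.single i 1 =
      γ + (Finsupp.single (Fin.last n) k + Finsupp.single i 1) := by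
    rw [hαγ, add_comm _ γ, add_assoc]
  have hpow : ∀ l : ℕ, (X (Fin.last n) ^ l * X i ^ (k + 1 - l) *
      ((k + 1).choose l : MvPolynomial (Fin (n + 1)) K) :
      MvPolynomial (Fin (n + 1)) K) = monomial (Finsupp.single (Fin.last n) l +
        Finsupp.single i (k + 1 - l)) ((k + 1).choose l : K) := fun l => by
    rw [X_pow_eq_monomial, X_pow_eq_monomial, monomial_mul,
      ← map_natCast (C (σ := Fin (n + 1)) (R := K)), mul_comm,
      C_mul_monomial]
    simp
  rw [h3, coeff_monomial_mul, one_mul, add_pow, coeff_sum, Finset.sum_eq_single k]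
  · rw [hpow, coeff_monomial, if_pos (by simp)]
    simpa using Nat.cast_add_one_ne_zero k
  · intro l _ hl
    rw [hpow, coeff_monomial, if_neg]
    intro h
    have := DFunLike.congr_fun h (Fin.last n)
    simp [hlin.symm] at this
    exact hl this
  · simp

end Algebra

/-! ### Shadows and the Hilbert function -/

section Shadow

variable {K : Type*} [Field K] {n : ℕ} {ord : MonomialOrder (Fin (n + 1))}
  {J : Ideal (MvPolynomial (Fin (n + 1)) K)}

/-- The points of `ℝ^n` that dominate, in the first `n` coordinates, an initial exponent of `J` of
degree at most `s`. -/
def shadow (ord : MonomialOrder (Fin (n + 1))) (J : Ideal (MvPolynomial (Fin (n + 1)) K))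
    (s : ℝ) : Set (Fin n → ℝ) :=
  {γ | ∃ α ∈ initialExponents ord J, (α.degree : ℝ) ≤ s ∧ ∀ j : Fin n, (α j.castSucc : ℝ) ≤ γ j}

lemma isUpperSet_shadow (s : ℝ) : IsUpperSet (shadow ord J s) :=
  fun _ _ hle ⟨α, hα, hs, hγ⟩ => ⟨α, hα, hs, fun j => (hγ j).trans (hle j)⟩

lemma degree_eq_sum_castSucc (α : Fin (n + 1) →₀ ℕ) :
    α.degree = ∑ j : Fin n, α j.castSucc + α (Fin.last n) := by
  rw [Finsupp.degree_eq_sum, Fin.sum_univ_castSucc]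

lemma setL_eq (I : ℕ → Ideal (MvPolynomial (Fin (n + 1)) K)) (m : ℕ) (t : ℝ) :
    setL ord I m t = shadow ord (I m) (m * t) ∩ simplexT n (m * t) := by
  ext γ
  refine and_congr_left fun _ => ?_
  constructor
  · rintro ⟨β, ⟨α, hα, hαβ, hβ⟩, hβγ⟩
    refine ⟨α, monomial_mem_initialIdeal_iff.1 hα, ?_, fun j => (hαβ j).trans (hβγ j)⟩
    have := Finset.sum_le_sum fun j (_ : j ∈ Finset.univ) => hαβ j
    rw [degree_eq_sum_castSucc]
    push_cast
    linarith
  · rintro ⟨α, hα, hs, hγ⟩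
    refine ⟨fun j => α j.castSucc, ⟨α, monomial_mem_initialIdeal_iff.2 hα, fun _ => le_rfl, ?_⟩, hγ⟩
    rw [degree_eq_sum_castSucc] at hs
    push_cast at hs
    linarith

lemma floor_mem_shadow_iff {s : ℝ} {γ : Fin n → ℝ} (hγ : ∀ j, 0 ≤ γ j) :
    (fun j => (⌊γ j⌋₊ : ℝ)) ∈ shadow ord J s ↔ γ ∈ shadow ord J s := by
  refine exists_congr fun α => and_congr_right fun _ => and_congr_right fun _ =>
    forall_congr' fun j => ?_
  rw [Nat.cast_le, Nat.le_floor_iff (hγ j)]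

/-- Stability of the initial exponents: an excess in the last variable may be moved to the earlier
ones, so only the first `n` coordinates and the total degree matter. -/
lemma mem_initialExponents_of_le [CharZero K] (hB : IsBorelFixed (initialIdeal ord J))
    {α β : Fin (n + 1) →₀ ℕ} (hβ : β ∈ initialExponents ord J) (hdeg : β.degree ≤ α.degree)
    (hle : ∀ j : Fin n, β j.castSucc ≤ α j.castSucc) : α ∈ initialExponents ord J := by
  induction hk : β (Fin.last n) generalizing β with
  | zero =>
    refine isUpperSet_initialExponents (fun j => ?_) hβ
    induction j using Fin.lastCases with
    | last => simp [hk]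
    | cast j => exact hle j
  | succ k ih =>
    by_cases hlast : β (Fin.last n) ≤ α (Fin.last n)
    · refine isUpperSet_initialExponents (fun j => ?_) hβ
      induction j using Fin.lastCases with
      | last => exact hlast
      | cast j => exact hle j
    · rw [degree_eq_sum_castSucc, degree_eq_sum_castSucc] at hdeg
      obtain ⟨i, -, hi⟩ : ∃ i ∈ (Finset.univ : Finset (Fin n)), β i.castSucc < α i.castSucc :=
        Finset.exists_lt_of_sum_lt (by omega)
      have hsub : β - Finsupp.single (Fin.last n) 1 + Finsupp.single (Fin.last n) 1 = β := by
        refine tsub_add_cancel_of_le (Finsupp.single_le_iff.2 (by omega))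
      have hne : ∀ j : Fin n, Fin.last n ≠ j.castSucc := fun j => (Fin.castSucc_lt_last j).ne'
      rw [← hsub] at hβ
      refine ih (exchange_mem_initialExponents hB (Fin.castSucc_lt_last i) hβ) ?_ ?_ ?_
      · rw [degree_eq_sum_castSucc α, map_add, Finsupp.degree_single]
        have h := congrArg Finsupp.degree hsub
        rw [map_add, Finsupp.degree_single, degree_eq_sum_castSucc β] at h
        omega
      · intro j
        have := hle j
        by_cases hij : i = j
        · subst hij
          simp
          omega
        · simpa [Finsupp.single_apply, hne, hij] using this
      · simp [(hne i).symm, hk]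

/-- The lattice points of `T_s^n` that lie outside the shadow of `J`. -/
def outerLattice (ord : MonomialOrder (Fin (n + 1))) (J : Ideal (MvPolynomial (Fin (n + 1)) K))
    (s : ℝ) : Set (Fin n → ℕ) :=
  {a | ((∑ j, a j : ℕ) : ℝ) ≤ s ∧ (fun j => (a j : ℝ)) ∉ shadow ord J s}

lemma finite_outerLattice (s : ℝ) : (outerLattice ord J s).Finite := by
  refine (Set.finite_Iic (fun _ : Fin n => ⌊s⌋₊)).subset fun a ha j => Nat.le_floor ?_
  refine le_trans (Nat.cast_le.2 ?_) ha.1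
  exact Finset.single_le_sum (fun _ _ => Nat.zero_le _) (Finset.mem_univ j)

/-- Dropping the last coordinate identifies the standard monomials of degree `⌊s⌋` with the lattice
points of `T_s^n` outside the shadow. -/
lemma extHilbertFunction_eq_ncard [CharZero K] (hJ : IsHomogeneousIdeal J)
    (hB : IsBorelFixed (initialIdeal ord J)) (s : ℝ) :
    extHilbertFunction J s = (outerLattice ord J s).ncard := by
  rw [extHilbertFunction]
  split_ifs with hs
  · rw [eq_comm, Set.ncard_eq_zero (finite_outerLattice s)]
    refine Set.eq_empty_of_forall_notMem fun a ha => hs.not_ge (le_trans ?_ ha.1)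
    positivity
  rw [not_lt] at hs
  have hiff : ∀ α : Fin (n + 1) →₀ ℕ, α.degree = ⌊s⌋₊ →
      (α ∈ initialExponents ord J ↔ (fun j : Fin n => (α j.castSucc : ℝ)) ∈ shadow ord J s) := by
    intro α hα
    constructor
    · intro h
      exact ⟨α, h, by rw [hα]; exact Nat.floor_le hs, fun _ => le_rfl⟩
    · rintro ⟨β, hβ, hβs, hle⟩
      exact mem_initialExponents_of_le hB hβ (by rw [hα]; exact Nat.le_floor hβs)
        fun j => Nat.cast_le.1 (hle j)
  rw [hilbertFunction_eq_ncard ord hJ]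
  refine Set.ncard_congr (fun α _ j => α (Fin.castSucc j)) ?_ ?_ ?_
  · rintro α ⟨hα, hst⟩
    refine ⟨?_, fun h => hst ((hiff α hα).2 h)⟩
    refine le_trans (Nat.cast_le.2 ?_) (Nat.floor_le hs)
    have := degree_eq_sum_castSucc α
    simp only
    omega
  · rintro α β ⟨hα, -⟩ ⟨hβ, -⟩ h
    have h' : ∀ j : Fin n, α j.castSucc = β j.castSucc := fun j => congrFun h j
    have h1 := degree_eq_sum_castSucc α
    have h2 := degree_eq_sum_castSucc β
    simp only [h'] at h1
    ext j
    induction j using Fin.lastCases with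
    | last => omega
    | cast j => exact h' j
  · rintro a ⟨ha, hst⟩
    have ha' := Nat.le_floor ha
    set α : Fin (n + 1) →₀ ℕ :=
      Finsupp.equivFunOnFinite.symm (Fin.snoc (α := fun _ => ℕ) a (⌊s⌋₊ - ∑ j, a j)) with hα
    have hcast : ∀ j : Fin n, α j.castSucc = a j := fun j => by simp [hα]
    have hdeg : α.degree = ⌊s⌋₊ := by
      rw [degree_eq_sum_castSucc]
      simp only [hcast]
      simp only [hα, Finsupp.equivFunOnFinite_symm_apply_apply, Fin.snoc_last]
      omega
    refine ⟨α, ⟨hdeg, fun h => hst ?_⟩, funext hcast⟩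
    simpa only [hcast] using (hiff α hdeg).1 h

end Shadow

/-! ### Volumes of unions of cells -/

section Cells

variable {n : ℕ}

/-- The union of the half-open cells of side `1/r` attached to the points of `B / r`. -/
def cells (B : Set (Fin n → ℕ)) (r : ℝ) : Set (Fin n → ℝ) :=
  {γ | (∀ j, 0 ≤ γ j) ∧ (fun j => ⌊r * γ j⌋₊) ∈ B}

lemma cells_eq_iUnion (B : Set (Fin n → ℕ)) {r : ℝ} (hr : 0 < r) :
    cells B r = ⋃ a ∈ B, Set.univ.pi fun j => Set.Ico ((a j : ℝ) / r) (((a j : ℝ) + 1) / r) := by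
  ext γ
  simp only [cells, Set.mem_ofPred_eq, Set.mem_iUnion, Set.mem_univ_pi, Set.mem_Ico, exists_prop,
    div_le_iff₀ hr, lt_div_iff₀ hr]
  constructor
  · rintro ⟨h0, hB⟩
    refine ⟨_, hB, fun j => ⟨?_, ?_⟩⟩
    · rw [mul_comm (γ j) r]; exact Nat.floor_le (mul_nonneg hr.le (h0 j))
    · rw [mul_comm (γ j) r]; exact Nat.lt_floor_add_one _
  · rintro ⟨a, ha, h⟩
    have h0 : ∀ j, 0 ≤ γ j := fun j =>
      nonneg_of_mul_nonneg_left ((Nat.cast_nonneg (a j)).trans (h j).1) hr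
    refine ⟨h0, ?_⟩
    convert ha using 2 with j
    rw [Nat.floor_eq_iff (mul_nonneg hr.le (h0 j)), mul_comm]
    exact h j

lemma measurableSet_cells (B : Set (Fin n → ℕ)) {r : ℝ} (hr : 0 < r) :
    MeasurableSet (cells B r) := by
  rw [cells_eq_iUnion B hr]
  exact MeasurableSet.biUnion B.to_countable fun a _ =>
    MeasurableSet.univ_pi fun j => measurableSet_Ico

lemma volume_cells {B : Set (Fin n → ℕ)} (hB : B.Finite) {r : ℝ} (hr : 0 < r) :
    volume (cells B r) = ENNReal.ofReal (B.ncard / r ^ n) := by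
  have hdisj : B.PairwiseDisjoint fun a =>
      Set.univ.pi fun j => Set.Ico ((a j : ℝ) / r) (((a j : ℝ) + 1) / r) := by
    intro a _ b _ hab
    refine Set.disjoint_left.2 fun γ ha hb => hab (funext fun j => ?_)
    have ha := ha j trivial
    have hb := hb j trivial
    simp only [Set.mem_Ico, div_le_iff₀ hr, lt_div_iff₀ hr] at ha hb
    have h1 : (a j : ℝ) < b j + 1 := ha.1.trans_lt hb.2
    have h2 : (b j : ℝ) < a j + 1 := hb.1.trans_lt ha.2
    have h1 : a j < b j + 1 := by exact_mod_cast h1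
    have h2 : b j < a j + 1 := by exact_mod_cast h2
    omega
  rw [cells_eq_iUnion B hr, ← hB.coe_toFinset, Set.ncard_coe_finset]
  simp only [Finset.mem_coe]
  rw [measure_biUnion_finset (by simpa using hdisj)
      fun a _ => MeasurableSet.univ_pi fun j => measurableSet_Ico]
  have : ∀ a : Fin n → ℕ, volume (Set.univ.pi fun j =>
      Set.Ico ((a j : ℝ) / r) (((a j : ℝ) + 1) / r)) = ENNReal.ofReal ((r ^ n)⁻¹) := by
    intro a
    rw [Real.volume_pi_Ico]
    simp [← sub_div, ENNReal.ofReal_pow (inv_nonneg.2 hr.le), ← inv_pow]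
  simp only [this, Finset.sum_const, nsmul_eq_mul]
  rw [div_eq_mul_inv, ENNReal.ofReal_mul (Nat.cast_nonneg _), ENNReal.ofReal_natCast]

end Cells

/-! ### Convergence to the limiting shape -/

section LimitShape

variable {K : Type*} [Field K] {n : ℕ} {ord : MonomialOrder (Fin (n + 1))}
  {I : ℕ → Ideal (MvPolynomial (Fin (n + 1)) K)} {t : ℝ}

/-- The points of `T_t^n` none of whose positive integral multiples `m γ` lies in the shadow of
`I_m`. -/
def outerShape (ord : MonomialOrder (Fin (n + 1)))
    (I : ℕ → Ideal (MvPolynomial (Fin (n + 1)) K)) (t : ℝ) : Set (Fin n → ℝ) :=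
  {γ ∈ simplexT n t | ∀ m : ℕ, 1 ≤ m → (m : ℝ) • γ ∉ shadow ord (I m) (m * t)}

lemma smul_mem_simplexT_iff {r : ℝ} (hr : 0 < r) {γ : Fin n → ℝ} :
    r • γ ∈ simplexT n (r * t) ↔ γ ∈ simplexT n t := by
  simp [simplexT, ← Finset.mul_sum, hr]

lemma complementShape_eq_closure : complementShape ord I t = closure (outerShape ord I t) := by
  rw [complementShape]
  congr 1
  ext γ
  simp only [Set.mem_iInter]
  have hpos : ∀ m : ℕ, 1 ≤ m → (0 : ℝ) < m := fun m hm => by exact_mod_cast hm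
  have hmem : ∀ m : ℕ, 1 ≤ m → γ ∈ simplexT n t →
      (γ ∈ (m : ℝ)⁻¹ • setL ord I m t ↔ (m : ℝ) • γ ∈ shadow ord (I m) (m * t)) := by
    intro m hm hγ
    rw [Set.mem_inv_smul_set_iff₀ (hpos m hm).ne', setL_eq]
    exact and_iff_left ((smul_mem_simplexT_iff (hpos m hm)).2 hγ)
  constructor
  · intro h
    have h1 : γ ∈ simplexT n t := by simpa using (h 1 le_rfl).1
    exact ⟨h1, fun m hm hs => (h m hm).2 ((hmem m hm h1).2 hs)⟩
  · rintro ⟨h1, h⟩ m hm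
    have ht : 0 ≤ t := (Finset.sum_nonneg fun j _ => h1.1 j).trans h1.2
    refine ⟨⟨h1.1, h1.2.trans ?_⟩, fun hs => h m hm ((hmem m hm h1).1 hs)⟩
    exact le_mul_of_one_le_left ht (by exact_mod_cast hm)

lemma ordConnected_simplexT : (simplexT n t).OrdConnected :=
  ⟨fun _ ha _ hb _ hx => ⟨fun j => (ha.1 j).trans (hx.1 j),
    (Finset.sum_le_sum fun j _ => hx.2 j).trans hb.2⟩⟩

lemma ordConnected_outerShape : (outerShape ord I t).OrdConnected :=
  ⟨fun _ ha _ hb _ hx => ⟨ordConnected_simplexT.out ha.1 hb.1 hx, fun m hm hs => hb.2 m hm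
    (isUpperSet_shadow _ (smul_le_smul_of_nonneg_left hx.2 (Nat.cast_nonneg m)) hs)⟩⟩

lemma nsmul_mem_initialExponents (hgraded : ∀ p q : ℕ, I p * I q ≤ I (p + q)) {q c : ℕ}
    (hc : 1 ≤ c) {α : Fin (n + 1) →₀ ℕ} (hα : α ∈ initialExponents ord (I q)) :
    c • α ∈ initialExponents ord (I (c * q)) := by
  induction c, hc using Nat.le_induction with
  | base => simpa using hα
  | succ c _ ih =>
    rw [succ_nsmul, Nat.succ_mul]
    exact initialExponents_add (hgraded _ _) ih hα

/-- If the shadows along the multiples of `p` are eventually nonempty, then a point that stays in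
some `q`-th shadow after a small translation in the direction `-(1,…,1)` lies in all of them from
some index on. -/
lemma eventually_smul_mem_shadow (hgraded : ∀ p q : ℕ, I p * I q ≤ I (p + q)) {p : ℕ} (hp : 1 ≤ p)
    {k₀ : ℕ} (hk₀ : ∀ k ≥ k₀, ∃ β ∈ initialExponents ord (I (k * p)),
      (β.degree : ℝ) ≤ (k * p : ℕ) * t)
    {γ : Fin n → ℝ} (hγ : ∀ j, 0 ≤ γ j) {ε : ℝ} (hε : 0 < ε) {q : ℕ} (hq : 1 ≤ q)
    (hs : (q : ℝ) • (γ - fun _ => ε) ∈ shadow ord (I q) (q * t)) :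
    ∀ᶠ k : ℕ in atTop, ((k * p : ℕ) : ℝ) • γ ∈ shadow ord (I (k * p)) ((k * p : ℕ) * t) := by
  obtain ⟨α, hα, hαs, hαγ⟩ := hs
  choose! β hβ hβs using hk₀
  set C : ℕ := ∑ r ∈ Finset.range q, (β (k₀ + r)).degree
  obtain ⟨N, hN⟩ := exists_nat_ge ((C : ℝ) / ε)
  rw [div_le_iff₀ hε] at hN
  filter_upwards [eventually_ge_atTop (k₀ + q * (N + 1))] with k hk
  -- `k = j q + i` with `k₀ ≤ i < k₀ + q`, and `j` large
  set r := (k - k₀) % q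
  set j := (k - k₀) / q
  have hr : r < q := Nat.mod_lt _ hq
  have hj : N + 1 ≤ j := (Nat.le_div_iff_mul_le hq).2 (by rw [mul_comm]; omega)
  have hkj : k = q * j + (k₀ + r) := by
    have := Nat.div_add_mod (k - k₀) q
    change q * j + r = k - k₀ at this
    have : k₀ ≤ k := le_trans (Nat.le_add_right _ _) hk
    omega
  have hm : k * p = (j * p) * q + (k₀ + r) * p := by rw [hkj]; ring
  have hC : (β (k₀ + r)).degree ≤ C :=
    Finset.single_le_sum (f := fun r => (β (k₀ + r)).degree) (fun _ _ => Nat.zero_le _)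
      (Finset.mem_range.2 hr)
  have hjp : 1 ≤ j * p := Nat.mul_pos (by omega) hp
  refine ⟨(j * p) • α + β (k₀ + r), ?_, ?_, fun l => ?_⟩
  · rw [hm]
    exact initialExponents_add (hgraded _ _) (nsmul_mem_initialExponents hgraded hjp hα)
      (hβ _ (Nat.le_add_right _ _))
  · have h1 := hβs (k₀ + r) (Nat.le_add_right _ _)
    have h2 := mul_le_mul_of_nonneg_left hαs (Nat.cast_nonneg (α := ℝ) (j * p))
    rw [hm, map_add, map_nsmul]
    push_cast at h1 h2 ⊢
    simp only [smul_eq_mul]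
    push_cast
    linarith
  · have h1 := mul_le_mul_of_nonneg_left (hαγ l) (Nat.cast_nonneg (α := ℝ) (j * p))
    have h2 : ((β (k₀ + r)) l.castSucc : ℝ) ≤ C := by
      exact_mod_cast (Finsupp.le_degree _ _).trans hC
    have h3 : (C : ℝ) ≤ (j * p : ℕ) * q * ε := by
      have hle : N ≤ j * p * q := by
        calc N ≤ j := by omega
          _ ≤ j * p := Nat.le_mul_of_pos_right _ hp
          _ ≤ j * p * q := Nat.le_mul_of_pos_right _ hq
      refine hN.trans (mul_le_mul_of_nonneg_right ?_ hε.le)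
      exact_mod_cast hle
    have h4 : (0 : ℝ) ≤ ((k₀ + r) * p : ℕ) * γ l := mul_nonneg (Nat.cast_nonneg _) (hγ l)
    rw [hm]
    simp only [Pi.smul_apply, Pi.sub_apply, smul_eq_mul, Finsupp.add_apply, Finsupp.smul_apply]
      at h1 ⊢
    push_cast at h1 h2 h3 h4 ⊢
    linarith

lemma cells_outerLattice_subset_Icc {J : Ideal (MvPolynomial (Fin (n + 1)) K)} {m : ℕ}
    (hm : 1 ≤ m) :
    cells (outerLattice ord J (m * t)) m ⊆ Set.Icc (fun _ => 0) (fun _ => t + 1) := by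
  rintro γ ⟨h0, hB, -⟩
  refine ⟨h0, fun j => ?_⟩
  have hm' : (1 : ℝ) ≤ m := by exact_mod_cast hm
  have h1 : (⌊m * γ j⌋₊ : ℝ) ≤ m * t := by
    refine le_trans (Nat.cast_le.2 ?_) hB
    exact Finset.single_le_sum (f := fun j => ⌊m * γ j⌋₊) (fun _ _ => Nat.zero_le _)
      (Finset.mem_univ j)
  have h2 := Nat.lt_floor_add_one (m * γ j)
  have h3 : (m : ℝ) * γ j ≤ m * (t + 1) := by linarith
  exact le_of_mul_le_mul_left h3 (by linarith)

lemma mem_cells_outerLattice {m : ℕ} (hm : 1 ≤ m) {γ : Fin n → ℝ}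
    (hγ : γ ∈ outerShape ord I t) : γ ∈ cells (outerLattice ord (I m) (m * t)) m := by
  refine ⟨hγ.1.1, ?_, fun hs => hγ.2 m hm ?_⟩
  · push_cast
    calc ∑ j, (⌊(m : ℝ) * γ j⌋₊ : ℝ) ≤ ∑ j, (m : ℝ) * γ j := Finset.sum_le_sum fun j _ =>
          Nat.floor_le (mul_nonneg (Nat.cast_nonneg _) (hγ.1.1 j))
      _ = m * ∑ j, γ j := by rw [Finset.mul_sum]
      _ ≤ m * t := mul_le_mul_of_nonneg_left hγ.1.2 (Nat.cast_nonneg _)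
  · exact (floor_mem_shadow_iff fun j => mul_nonneg (Nat.cast_nonneg _) (hγ.1.1 j)).1 hs

lemma notMem_cells_of_smul_mem_shadow {m : ℕ} {γ : Fin n → ℝ}
    (hs : (m : ℝ) • γ ∈ shadow ord (I m) (m * t)) :
    γ ∉ cells (outerLattice ord (I m) (m * t)) m := by
  rintro ⟨h0, -, hB⟩
  exact hB ((floor_mem_shadow_iff fun j => mul_nonneg (Nat.cast_nonneg _) (h0 j)).2 hs)

lemma eventually_notMem_cells_of_lt_sum {γ : Fin n → ℝ} (hγ : t < ∑ j, γ j) :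
    ∀ᶠ m : ℕ in atTop, γ ∉ cells (outerLattice ord (I m) (m * t)) m := by
  have hlim : Tendsto (fun m : ℕ => (m : ℝ) * (∑ j, γ j - t)) atTop atTop :=
    tendsto_natCast_atTop_atTop.atTop_mul_const (sub_pos.2 hγ)
  filter_upwards [hlim.eventually_gt_atTop (n : ℝ)] with m hm
  rintro ⟨-, hB, -⟩
  have : ∑ j, ((m : ℝ) * γ j - 1) ≤ ∑ j, (⌊(m : ℝ) * γ j⌋₊ : ℝ) :=
    Finset.sum_le_sum fun j _ => (Nat.sub_one_lt_floor _).le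
  rw [Finset.sum_sub_distrib, ← Finset.mul_sum] at this
  push_cast at hB
  simp at this
  linarith

/-- The cells of the lattice points outside the shadows of `I_m`, scaled by `1/m`, converge almost
everywhere to the outer shape, when `m` runs through the multiples of a `p` for which the shadows
are eventually nonempty, or when all shadows are empty. -/
lemma ae_eventually_mem_cells_iff (hgraded : ∀ p q : ℕ, I p * I q ≤ I (p + q)) {p : ℕ}
    (hp : 1 ≤ p)
    (H : (∀ q : ℕ, 1 ≤ q → ∀ α ∈ initialExponents ord (I q), ¬ (α.degree : ℝ) ≤ q * t) ∨
      ∃ k₀ : ℕ, ∀ k ≥ k₀, ∃ β ∈ initialExponents ord (I (k * p)),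
        (β.degree : ℝ) ≤ (k * p : ℕ) * t) :
    ∀ᵐ γ : Fin n → ℝ, ∀ᶠ k : ℕ in atTop,
      (γ ∈ cells (outerLattice ord (I (k * p)) ((k * p : ℕ) * t)) (k * p : ℕ) ↔
        γ ∈ closure (outerShape ord I t)) := by
  have hmul : Tendsto (fun k : ℕ => k * p) atTop atTop := tendsto_id.atTop_mul_const' hp
  have hfr : ∀ {s : Set (Fin n → ℝ)}, volume (frontier s) = 0 → ∀ᵐ γ, γ ∉ frontier s :=
    fun h => measure_eq_zero_iff_ae_notMem.1 h
  filter_upwards [hfr (ordConnected_outerShape (ord := ord) (I := I) (t := t)).null_frontier,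
    hfr (ordConnected_simplexT (n := n) (t := t)).null_frontier] with γ hW hT
  by_cases hγ : γ ∈ outerShape ord I t
  · filter_upwards [hmul.eventually_ge_atTop 1] with k hk
    exact iff_of_true (mem_cells_outerLattice hk hγ) (subset_closure hγ)
  have hcl : γ ∉ closure (outerShape ord I t) := fun h =>
    hW ⟨h, fun hi => hγ (interior_subset hi)⟩
  suffices h : ∀ᶠ k : ℕ in atTop,
      γ ∉ cells (outerLattice ord (I (k * p)) ((k * p : ℕ) * t)) (k * p : ℕ) from
    h.mono fun k hk => iff_of_false hk hcl
  by_cases h0 : ∀ j, 0 ≤ γ j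
  swap
  · exact Eventually.of_forall fun k hk => h0 hk.1
  by_cases hsum : ∑ j, γ j ≤ t
  swap
  · exact hmul.eventually (eventually_notMem_cells_of_lt_sum (not_le.1 hsum))
  have hint : γ ∈ interior (simplexT n t) := by
    by_contra h
    exact hT ⟨subset_closure ⟨h0, hsum⟩, h⟩
  -- a small translate of `γ` in the direction `-(1,…,1)` is still in `T_t^n` and
  -- outside the outer shape
  have hlim : Tendsto (fun ε : ℝ => γ - fun _ => ε) (𝓝[>] 0) (𝓝 γ) := by
    have : Continuous fun ε : ℝ => γ - fun _ => ε := by fun_prop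
    have h := (this.tendsto 0).mono_left (nhdsWithin_le_nhds (s := Set.Ioi 0))
    have h00 : (γ - fun _ => (0 : ℝ)) = γ := sub_zero γ
    rwa [h00] at h
  obtain ⟨ε, ⟨hεT, hεW⟩, hε⟩ := ((hlim.eventually (inter_mem (mem_interior_iff_mem_nhds.1 hint)
    (isClosed_closure.isOpen_compl.mem_nhds hcl))).and self_mem_nhdsWithin).exists
  have hex : ∃ q : ℕ, 1 ≤ q ∧ (q : ℝ) • (γ - fun _ => ε) ∈ shadow ord (I q) (q * t) := by
    by_contra! hno
    exact hεW (subset_closure ⟨hεT, hno⟩)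
  obtain ⟨q, hq, hs⟩ := hex
  rcases H with H | ⟨k₀, H⟩
  · obtain ⟨α, hα, hαs, -⟩ := hs
    exact absurd hαs (H q hq α hα)
  · exact (eventually_smul_mem_shadow hgraded hp H h0 hε hq hs).mono fun k hk =>
      notMem_cells_of_smul_mem_shadow hk

lemma volume_complementShape_ne_top : volume (complementShape ord I t) ≠ ⊤ := by
  rw [complementShape_eq_closure]
  have hsub : outerShape ord I t ⊆ Set.Icc (fun _ => 0) (fun _ => t) := fun γ hγ =>
    ⟨hγ.1.1, fun j => (Finset.single_le_sum (fun i _ => hγ.1.1 i) (Finset.mem_univ j)).trans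
      hγ.1.2⟩
  exact ((measure_mono (closure_minimal hsub isClosed_Icc)).trans_lt
    isCompact_Icc.measure_lt_top).ne

/-- The volume of the cells is the normalized Hilbert function. -/
lemma volume_cells_outerLattice [CharZero K] (hhom : ∀ m : ℕ, IsHomogeneousIdeal (I m))
    (hborel : ∀ m : ℕ, IsBorelFixed (initialIdeal ord (I m))) {m : ℕ} (hm : 1 ≤ m) :
    volume (cells (outerLattice ord (I m) (m * t)) m) = ENNReal.ofReal (hilbertSeq I t m) := by
  rw [volume_cells (finite_outerLattice _) (by exact_mod_cast hm), hilbertSeq,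
    extHilbertFunction_eq_ncard (hhom m) (hborel m)]

lemma tendsto_hilbertSeq_mul [CharZero K] (hgraded : ∀ p q : ℕ, I p * I q ≤ I (p + q))
    (hhom : ∀ m : ℕ, IsHomogeneousIdeal (I m))
    (hborel : ∀ m : ℕ, IsBorelFixed (initialIdeal ord (I m))) {p : ℕ} (hp : 1 ≤ p)
    (H : (∀ q : ℕ, 1 ≤ q → ∀ α ∈ initialExponents ord (I q), ¬ (α.degree : ℝ) ≤ q * t) ∨
      ∃ k₀ : ℕ, ∀ k ≥ k₀, ∃ β ∈ initialExponents ord (I (k * p)),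
        (β.degree : ℝ) ≤ (k * p : ℕ) * t) :
    Tendsto (fun k : ℕ => hilbertSeq I t (k * p)) atTop
      (𝓝 (volume (complementShape ord I t)).toReal) := by
  -- the shifted index avoids `m = 0`, where the cells have side `1 / 0`
  rw [← tendsto_add_atTop_iff_nat 1]
  have hm : ∀ k : ℕ, 1 ≤ (k + 1) * p := fun k => Nat.mul_pos k.succ_pos hp
  have hvol := tendsto_measure_of_ae_tendsto_indicator (μ := (volume : Measure (Fin n → ℝ)))
    (L := atTop) (A := complementShape ord I t)
    (As := fun k : ℕ => cells (outerLattice ord (I ((k + 1) * p)) (((k + 1) * p : ℕ) * t))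
      ((k + 1) * p : ℕ)) (B := Set.Icc (fun _ => 0) (fun _ => t + 1))
    isClosed_closure.measurableSet
    (fun k => measurableSet_cells _ (by exact_mod_cast hm k)) measurableSet_Icc
    isCompact_Icc.measure_lt_top.ne
    (Eventually.of_forall fun k => cells_outerLattice_subset_Icc (hm k)) (by
      rw [complementShape_eq_closure]
      filter_upwards [ae_eventually_mem_cells_iff hgraded hp H] with γ hγ
      exact (tendsto_add_atTop_nat 1).eventually hγ)
  have := (ENNReal.tendsto_toReal volume_complementShape_ne_top).comp hvol
  refine this.congr fun k => ?_
  simp only [Function.comp_apply]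
  rw [volume_cells_outerLattice hhom hborel (hm k), ENNReal.toReal_ofReal]
  exact div_nonneg (Nat.cast_nonneg _) (pow_nonneg (Nat.cast_nonneg _) _)

end LimitShape

/-! ### The Waldschmidt constant -/

section Waldschmidt

variable {K : Type*} [Field K] {n : ℕ} {I : ℕ → Ideal (MvPolynomial (Fin (n + 1)) K)}

lemma leastDegree_le {J : Ideal (MvPolynomial (Fin (n + 1)) K)} {d : ℕ}
    {f : MvPolynomial (Fin (n + 1)) K} (hf : f ∈ J) (hf0 : f ≠ 0) (hd : f.IsHomogeneous d) :
    leastDegree J ≤ d :=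
  Nat.sInf_le ⟨f, hf, hf0, hd⟩

lemma exists_form_of_ne_bot {J : Ideal (MvPolynomial (Fin (n + 1)) K)} (hJ : IsHomogeneousIdeal J)
    (h : J ≠ ⊥) : ∃ f ∈ J, f ≠ 0 ∧ f.IsHomogeneous (leastDegree J) := by
  obtain ⟨g, hg, hg0⟩ := Submodule.exists_mem_ne_zero_of_ne_bot h
  have hne : {d | ∃ f ∈ J, f ≠ 0 ∧ f.IsHomogeneous d}.Nonempty := by
    by_contra hemp
    rw [Set.not_nonempty_iff_eq_empty] at hemp
    refine hg0 ?_
    rw [← sum_homogeneousComponent g]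
    refine Finset.sum_eq_zero fun d _ => by_contra fun hd => ?_
    exact Set.eq_empty_iff_forall_notMem.1 hemp d ⟨_, homogeneousComponent_mem_of_mem hJ hg d, hd,
      homogeneousComponent_isHomogeneous d g⟩
  exact Nat.sInf_mem hne

lemma subadditive_leastDegree (hgraded : ∀ p q : ℕ, I p * I q ≤ I (p + q))
    (hhom : ∀ m : ℕ, IsHomogeneousIdeal (I m)) (hne : ∀ m : ℕ, 1 ≤ m → I m ≠ ⊥) :
    Subadditive fun m => (leastDegree (I m) : ℝ) := by
  intro p q
  -- `I 0` may vanish, but then `0 + q` and `p + 0` make the inequality trivial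
  rcases Nat.eq_zero_or_pos p with rfl | hp
  · simp
  rcases Nat.eq_zero_or_pos q with rfl | hq
  · simp
  obtain ⟨f, hf, hf0, hfd⟩ := exists_form_of_ne_bot (hhom p) (hne p hp)
  obtain ⟨g, hg, hg0, hgd⟩ := exists_form_of_ne_bot (hhom q) (hne q hq)
  have h := leastDegree_le (hgraded p q (Ideal.mul_mem_mul hf hg)) (mul_ne_zero hf0 hg0)
    (hfd.mul hgd)
  simpa only [← Nat.cast_add, Nat.cast_le] using h

lemma bddBelow_leastDegree_div :
    BddBelow (Set.range fun m : ℕ => (leastDegree (I m) : ℝ) / m) :=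
  ⟨0, by rintro _ ⟨m, rfl⟩; positivity⟩

lemma waldschmidtConstant_eq_lim (h : Subadditive fun m => (leastDegree (I m) : ℝ)) :
    waldschmidtConstant I = h.lim :=
  (h.tendsto_lim bddBelow_leastDegree_div).limUnder_eq

/-- Below the Waldschmidt constant all shadows are empty, above it they are eventually nonempty. -/
lemma shadows_empty_or_eventually_nonempty {ord : MonomialOrder (Fin (n + 1))}
    (hgraded : ∀ p q : ℕ, I p * I q ≤ I (p + q))
    (hhom : ∀ m : ℕ, IsHomogeneousIdeal (I m)) (hne : ∀ m : ℕ, 1 ≤ m → I m ≠ ⊥) {t : ℝ}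
    (ht : t ≠ waldschmidtConstant I) :
    (∀ q : ℕ, 1 ≤ q → ∀ α ∈ initialExponents ord (I q), ¬ (α.degree : ℝ) ≤ q * t) ∨
      ∃ k₀ : ℕ, ∀ k ≥ k₀, ∃ β ∈ initialExponents ord (I k), (β.degree : ℝ) ≤ k * t := by
  have hsub := subadditive_leastDegree hgraded hhom hne
  rw [waldschmidtConstant_eq_lim hsub] at ht
  rcases ht.lt_or_gt with ht | ht
  · left
    intro q hq α hα hle
    obtain ⟨f, hf, hf0, hfd, -⟩ := exists_form_of_mem_initialExponents (hhom q) hα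
    have h1 : (leastDegree (I q) : ℝ) ≤ α.degree := by exact_mod_cast leastDegree_le hf hf0 hfd
    have h2 := hsub.lim_le_div bddBelow_leastDegree_div (Nat.one_le_iff_ne_zero.1 hq)
    have hq' : (0 : ℝ) < q := by exact_mod_cast hq
    rw [le_div_iff₀ hq'] at h2
    nlinarith
  · right
    obtain ⟨k₀, hk₀⟩ := eventually_atTop.1
      ((hsub.tendsto_lim bddBelow_leastDegree_div).eventually (gt_mem_nhds ht))
    refine ⟨k₀ + 1, fun k hk => ?_⟩
    have hk1 : 1 ≤ k := by omega
    obtain ⟨f, hf, hf0, hfd⟩ := exists_form_of_ne_bot (hhom k) (hne k hk1)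
    refine ⟨ord.degree f, ⟨f, hf, hf0, rfl⟩, ?_⟩
    have hdeg : (ord.degree f).degree = leastDegree (I k) := by
      by_contra h
      exact hf0 (ord.coeff_degree_eq_zero_iff.1 (hfd.coeff_eq_zero h))
    have h := hk₀ k (by omega)
    rw [div_lt_iff₀ (by exact_mod_cast hk1)] at h
    rw [hdeg]
    linarith

end Waldschmidt

end GradedSystem

theorem mainTheorem6 {K : Type*} [Field K] [CharZero K] (n : ℕ)
    (ord : MonomialOrder (Fin (n + 1)))
    (I : ℕ → Ideal (MvPolynomial (Fin (n + 1)) K))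
    (hgraded : ∀ p q : ℕ, I p * I q ≤ I (p + q))
    (hhom : ∀ m : ℕ, GradedSystem.IsHomogeneousIdeal (I m))
    (hborel : ∀ m : ℕ, GradedSystem.IsBorelFixed (GradedSystem.initialIdeal ord (I m)))
    (t : ℝ) :
    ((∀ m : ℕ, 1 ≤ m → I m ≠ ⊥) → t ≠ GradedSystem.waldschmidtConstant I →
        ∃ a : ℝ, Tendsto (GradedSystem.hilbertSeq I t) atTop (𝓝 a)) ∧
      ((∃ a : ℝ, Tendsto (GradedSystem.hilbertSeq I t) atTop (𝓝 a)) →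
        volume (GradedSystem.complementShape ord I t) =
          ENNReal.ofReal (GradedSystem.asymptoticHilbertFunction I t)) := by
  open GradedSystem in
  constructor
  · intro hne ht
    have h := tendsto_hilbertSeq_mul (p := 1) hgraded hhom hborel le_rfl (by
      simpa only [mul_one] using
        shadows_empty_or_eventually_nonempty (ord := ord) hgraded hhom hne ht)
    exact ⟨_, by simpa only [mul_one] using h⟩
  · rintro ⟨a, ha⟩
    -- it suffices to compute the limit along the multiples of one suitable `p`
    have hsub : ∃ p : ℕ, 1 ≤ p ∧ Tendsto (fun k : ℕ => hilbertSeq I t (k * p)) atTop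
        (𝓝 (volume (complementShape ord I t)).toReal) := by
      by_cases hemp : ∀ q : ℕ, 1 ≤ q → ∀ α ∈ initialExponents ord (I q), ¬ (α.degree : ℝ) ≤ q * t
      · exact ⟨1, le_rfl, tendsto_hilbertSeq_mul hgraded hhom hborel le_rfl (Or.inl hemp)⟩
      · push Not at hemp
        obtain ⟨p, hp, α, hα, hαt⟩ := hemp
        refine ⟨p, hp, tendsto_hilbertSeq_mul hgraded hhom hborel hp (Or.inr ⟨1, fun k hk =>
          ⟨k • α, nsmul_mem_initialExponents hgraded hk hα, ?_⟩⟩)⟩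
        have := mul_le_mul_of_nonneg_left hαt (Nat.cast_nonneg (α := ℝ) k)
        rw [map_nsmul]
        simp only [smul_eq_mul]
        push_cast
        linarith
    obtain ⟨p, hp, hlim⟩ := hsub
    have hmul : Tendsto (fun k : ℕ => k * p) atTop atTop := tendsto_id.atTop_mul_const' hp
    have heq := tendsto_nhds_unique (ha.comp hmul) hlim
    rw [asymptoticHilbertFunction, ha.limUnder_eq, heq,
      ENNReal.ofReal_toReal volume_complementShape_ne_top]
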